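/- Let $R$ be a commutative ring with unity, let $G=(V,E)$ be a finite simple graph, and let $\alpha$ assign to each edge $uv\in E$ an ideal $I_{uv}=\alpha(uv)$ of $R$. Let $$R_G=\{\,s:V\to R \;:\; s(u)-s(v)\in I_{uv}\ \text{for every edge } uv\,\}$$ be the ring of splines, with pointwise operations, and for $v\in V$ let $\iota_v:\operatorname{Spec}R\to\operatorname{Spec}R_G$ be induced by the evaluation $s\mapsto s(v)$. A \emph{Ferrand pushout} is a pushout square of schemes on $X\xleftarrow{\,i\,}Z\xrightarrow{\,j\,}Y$ in which $i$ is a closed immersion, $j$ is finite (hence integral), and for every $y\in Y$ there is an affine open $U\subseteq X$ with $j^{-1}(\{y\})\subseteq i^{-1}(U)$. (1) If $G$ is connected, then $\operatorname{Spec}(R_G)$, with its maps $\iota_v$, is obtained by finitely many Ferrand pushouts or coequalizers (in the category of schemes) of affine schemes along closed immersions. More precisely, it is obtained as follows. Start with one vertex and one copy of $\operatorname{Spec}R$. Whenever an affine scheme $X$ has been obtained, with maps $\iota^X_w:\operatorname{Spec}R\to X$ for the vertices $w$ of a subgraph $H$ of $G$, choose an edge $uv$ of $G$ that is not in $H$ and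 has $v\in H$, and add it to $H$ in the following way, replacing $X$ by the resulting affine scheme. (a) If $u\notin H$, form the Ferrand pushout of $X\leftarrow\operatorname{Spec}(R/I_{uv})\to\operatorname{Spec}R$, where the first map is $\operatorname{Spec}(R/I_{uv})\hookrightarrow\operatorname{Spec}R\xrightarrow{\iota^X_v}X$ and the second is the inclusion into a new copy of $\operatorname{Spec}R$, which belongs to $u$. Both maps are closed immersions. (b) If $u\in H$, form the coequalizer of the two maps $\operatorname{Spec}(R/I_{uv})\hookrightarrow\operatorname{Spec}R\rightrightarrows X$ through $\iota^X_u$ and $\iota^X_v$. Both of these composite maps are closed immersions. After finitely many such steps $H=G$, $X=\operatorname{Spec}(R_G)$ and $\iota^X_v=\iota_v$ for all $v$. (2) For arbitrary $G$, statement (1) holds for each connected component $G'$ of $G$ with the restricted labels, and $\operatorname{Spec}(R_G)$, with the maps induced by restricting splines, is the coproduct in the category of schemes of the $\operatorname{Spec}(R_{G'})$ over the connected components $G'$. (3) For arbitrary $G$, $\operatorname{Spec}(R_G)$ with its canonical maps is the colimit, in the category of schemes, of the diagram that has one copy of $\operatorname{Spec}R$ for each vertex, one copy of $\operatorname{Spec}(R/I_{uv})$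 for each edge $uv$, and the two closed immersions of $\operatorname{Spec}(R/I_{uv})$ into the copies of $\operatorname{Spec}R$ at $u$ and at $v$. -/

import Mathlib

open CategoryTheory CategoryTheory.Limits AlgebraicGeometry

universe u

namespace GraphSpline

section Rings

variable {V R : Type u} [CommRing R]

/-- The ring of splines `R_G` of an edge-labeled graph `(G, α)`: the vertex labelings `s : V → R`
with `s u - s v ∈ α (uv)` for every edge `uv`, with pointwise operations. -/
def splineRing (G : SimpleGraph V) (α : G.edgeSet → Ideal R) : Subring (V → R) where
  carrier := {s | ∀ (u v : V) (h : G.Adj u v), s u - s v ∈ α ⟨s(u, v), h⟩}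
  mul_mem' := by
    intro s t hs ht u v h
    have e : (s * t) u - (s * t) v = s u * (t u - t v) + t v * (s u - s v) := by
      simp only [Pi.mul_apply]; ring
    rw [e]
    exact Ideal.add_mem _ (Ideal.mul_mem_left _ _ (ht u v h)) (Ideal.mul_mem_left _ _ (hs u v h))
  one_mem' := by
    intro u v h
    simp
  add_mem' := by
    intro s t hs ht u v h
    have e : (s + t) u - (s + t) v = (s u - s v) + (t u - t v) := by
      simp only [Pi.add_apply]; ring
    rw [e]
    exact Ideal.add_mem _ (hs u v h) (ht u v h)
  zero_mem' := by
    intro u v h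
    simp
  neg_mem' := by
    intro s hs u v h
    have e : (-s) u - (-s) v = -(s u - s v) := by
      simp only [Pi.neg_apply]; ring
    rw [e]
    exact Submodule.neg_mem _ (hs u v h)

/-- The projection `R_G → R_v = R`, `s ↦ s v`. -/
def evalHom (G : SimpleGraph V) (α : G.edgeSet → Ideal R) (v : V) : splineRing G α →+* R :=
  (Pi.evalRingHom (fun _ : V => R) v).comp (splineRing G α).subtype

/-- The edge labeling pulled back along a graph homomorphism. -/
def pullbackLabel {V' : Type u} {G' : SimpleGraph V'} {G : SimpleGraph V} (φ : G' →g G)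
    (α : G.edgeSet → Ideal R) : G'.edgeSet → Ideal R :=
  fun e => α (φ.mapEdgeSet e)

/-- The ring homomorphism `R_G → R_{G'}`, `s ↦ s ∘ φ`. For the inclusion of a subgraph this is the
restriction of splines. -/
def restrictHom {V' : Type u} {G' : SimpleGraph V'} {G : SimpleGraph V} (φ : G' →g G)
    (α : G.edgeSet → Ideal R) : splineRing G α →+* splineRing G' (pullbackLabel φ α) where
  toFun s := ⟨fun v => s.1 (φ v), fun u v h => s.2 (φ u) (φ v) (φ.map_adj h)⟩
  map_one' := rfl
  map_mul' _ _ := rfl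
  map_zero' := rfl
  map_add' _ _ := rfl

/-- The two endpoint labels of an edge have the same class modulo the label of the edge. -/
theorem mk_eq_mk_of_mem (G : SimpleGraph V) (α : G.edgeSet → Ideal R) (s : splineRing G α)
    (e : G.edgeSet) {u v : V} (hu : u ∈ (e : Sym2 V)) (hv : v ∈ (e : Sym2 V)) :
    Ideal.Quotient.mk (α e) (s.1 u) = Ideal.Quotient.mk (α e) (s.1 v) := by
  by_cases huv : u = v
  · rw [huv]
  · obtain ⟨e, he⟩ := e
    obtain rfl : e = s(u, v) := (Sym2.mem_and_mem_iff huv).1 ⟨hu, hv⟩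
    exact Ideal.Quotient.eq.2 (s.2 u v he)

end Rings

section Diagram

variable {V : Type u}

/-- The shape of the spline diagram of `G`: one object per vertex and one object per edge. -/
inductive Shape (G : SimpleGraph V) : Type u
  | vertex (v : V) : Shape G
  | edge (e : G.edgeSet) : Shape G

/-- Besides the identities there is one arrow from a vertex to each edge that contains it. -/
inductive Shape.Hom (G : SimpleGraph V) : Shape G → Shape G → Type u
  | id (x : Shape G) : Shape.Hom G x x
  | incidence (v : V) (e : G.edgeSet) (h : v ∈ (e : Sym2 V)) :
      Shape.Hom G (Shape.vertex v) (Shape.edge e)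

/-- Composition of arrows of the shape. -/
def Shape.Hom.comp {G : SimpleGraph V} :
    {x y z : Shape G} → Shape.Hom G x y → Shape.Hom G y z → Shape.Hom G x z
  | _, _, _, .id _, g => g
  | _, _, _, .incidence v e h, .id _ => .incidence v e h

instance Shape.instSmallCategory (G : SimpleGraph V) : SmallCategory (Shape G) where
  Hom := Shape.Hom G
  id := Shape.Hom.id
  comp := Shape.Hom.comp
  id_comp _ := rfl
  comp_id f := by cases f <;> rfl
  assoc f g h := by cases f <;> cases g <;> cases h <;> rfl

variable {R : Type u} [CommRing R]

/-- The objects of the spline diagram: `R` at each vertex and `R / α e` at each edge `e`. -/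
def diagramObj (G : SimpleGraph V) (α : G.edgeSet → Ideal R) : Shape G → CommRingCat.{u}
  | .vertex _ => CommRingCat.of R
  | .edge e => CommRingCat.of (R ⧸ α e)

/-- The arrows of the spline diagram: the quotient maps `R_v → R / α e`. -/
def diagramMap (G : SimpleGraph V) (α : G.edgeSet → Ideal R) :
    {x y : Shape G} → Shape.Hom G x y → (diagramObj G α x ⟶ diagramObj G α y)
  | _, _, .id x => 𝟙 (diagramObj G α x)
  | _, _, .incidence _ e _ => CommRingCat.ofHom (Ideal.Quotient.mk (α e))

/-- The spline diagram of `(G, α)` in the category of commutative rings. -/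
def splineDiagram (G : SimpleGraph V) (α : G.edgeSet → Ideal R) : Shape G ⥤ CommRingCat.{u} where
  obj := diagramObj G α
  map f := diagramMap G α f
  map_id _ := rfl
  map_comp := by
    intro x y z (f : Shape.Hom G x y) (g : Shape.Hom G y z)
    cases f with
    | id x => exact (Category.id_comp _).symm
    | incidence v e h =>
      cases g with
      | id => exact (Category.comp_id _).symm

/-- The projections of `R_G` to the objects of the spline diagram: `s ↦ s v` at a vertex `v`, and
`s ↦ s v mod α e` at an edge `e`, where `v` is either endpoint of `e`. -/
noncomputable def splineProj (G : SimpleGraph V) (α : G.edgeSet → Ideal R) :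
    (x : Shape G) → (CommRingCat.of (splineRing G α) ⟶ diagramObj G α x)
  | .vertex v => CommRingCat.ofHom (evalHom G α v)
  | .edge e => CommRingCat.ofHom ((Ideal.Quotient.mk (α e)).comp (evalHom G α (e : Sym2 V).out.1))

/-- `R_G` with its projections, as a cone over the spline diagram. -/
noncomputable def splineCone (G : SimpleGraph V) (α : G.edgeSet → Ideal R) :
    Cone (splineDiagram G α) where
  pt := CommRingCat.of (splineRing G α)
  π :=
    { app := splineProj G α
      naturality := by
        intro x y (f : Shape.Hom G x y)
        cases f with
        | id x =>
          exact (Category.id_comp (splineProj G α x)).trans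
            (Category.comp_id (splineProj G α x)).symm
        | incidence v e h =>
          refine CommRingCat.hom_ext (RingHom.ext fun s => ?_)
          exact mk_eq_mk_of_mem G α s e (Sym2.out_fst_mem _) h }

/-- The spline diagram in the category of schemes: a copy of `Spec R` for each vertex, a copy of
`Spec (R / α e)` for each edge `e`, and the closed immersions of the latter into the copies of
`Spec R` at the two endpoints of `e`. -/
noncomputable def schemeDiagram (G : SimpleGraph V) (α : G.edgeSet → Ideal R) :
    (Shape G)ᵒᵖ ⥤ Scheme.{u} :=
  (splineDiagram G α).op ⋙ Scheme.Spec

/-- `Spec R_G` as a cocone under the spline diagram of schemes. -/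
noncomputable def schemeCocone (G : SimpleGraph V) (α : G.edgeSet → Ideal R) :
    Cocone (schemeDiagram G α) :=
  Scheme.Spec.mapCocone (splineCone G α).op

end Diagram

section Gluing

/-- A Ferrand pushout: a pushout `W` of `X ← Z → Y` in the category of schemes such that
`i : Z ⟶ X` is a closed immersion, `j : Z ⟶ Y` is finite (so integral), and for each `y : Y` the
fibre `j⁻¹(y)` is contained in `i⁻¹(U)` for some affine open `U` of `X`. -/
structure IsFerrandPushout {Z X Y W : Scheme.{u}} (i : Z ⟶ X) (j : Z ⟶ Y)
    (a : X ⟶ W) (b : Y ⟶ W) : Prop where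
  isPushout : IsPushout i j a b
  isClosedImmersion : IsClosedImmersion i
  isFinite : IsFinite j
  fibre_subset : ∀ y : Y, ∃ U : X.Opens, IsAffineOpen U ∧
    (j : Z → Y) ⁻¹' {y} ⊆ (i : Z → X) ⁻¹' (U : Set X)

variable {V R : Type u} [CommRing R]

/-- The canonical map `Spec R ⟶ Spec R_G` of the copy of `Spec R` at the vertex `v`. -/
noncomputable def vertexMap (G : SimpleGraph V) (α : G.edgeSet → Ideal R) (v : V) :
    Spec (CommRingCat.of R) ⟶ Spec (CommRingCat.of (splineRing G α)) :=
  Spec.map (CommRingCat.ofHom (evalHom G α v))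

/-- The closed subscheme `Spec (R / I) ⟶ Spec R`. -/
noncomputable def closedSub (I : Ideal R) :
    Spec (CommRingCat.of (R ⧸ I)) ⟶ Spec (CommRingCat.of R) :=
  Spec.map (CommRingCat.ofHom (Ideal.Quotient.mk I))

/-- `IsGluing G α H X ι`: the scheme `X`, with the copies `ι v : Spec R ⟶ X` of `Spec R` for the
vertices `v` of the subgraph `H` of `G`, is obtained by finitely many steps, as follows.
* `vertex`: start with a single vertex and (up to isomorphism) a single copy of `Spec R`.
* `pendant`: for an edge `uv` of `G` with `v` in `H` and `u` not in `H`, glue a new copy of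
  `Spec R` (for `u`) to `X` by a Ferrand pushout along `Spec (R / α (uv))`, embedded into `X`
  through the copy of `Spec R` at `v`.
* `chord`: for an edge `uv` of `G` that is not in `H` although `u` and `v` are, pass to the
  coequalizer of the two embeddings of `Spec (R / α (uv))` into `X` through the copies of `Spec R`
  at `u` and `v`.
All schemes are affine, and all the maps that one glues along are closed immersions. -/
inductive IsGluing (G : SimpleGraph V) (α : G.edgeSet → Ideal R) :
    (H : G.Subgraph) → (X : Scheme.{u}) → (H.verts → (Spec (CommRingCat.of R) ⟶ X)) → Prop
  | vertex (v : V) (X : Scheme.{u})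
      (ι : (G.singletonSubgraph v).verts → (Spec (CommRingCat.of R) ⟶ X))
      (hι : ∀ w, IsIso (ι w)) :
      IsGluing G α (G.singletonSubgraph v) X ι
  | pendant (H : G.Subgraph) (X : Scheme.{u}) (ι : H.verts → (Spec (CommRingCat.of R) ⟶ X))
      (hX : IsGluing G α H X ι)
      (u v : V) (huv : G.Adj u v) (hu : u ∉ H.verts) (hv : v ∈ H.verts)
      (W : Scheme.{u}) (hW : IsAffine W) (a : X ⟶ W) (b : Spec (CommRingCat.of R) ⟶ W)
      (hi : IsClosedImmersion (closedSub (α ⟨s(u, v), huv⟩) ≫ ι ⟨v, hv⟩))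
      (hj : IsClosedImmersion (closedSub (α ⟨s(u, v), huv⟩)))
      (hF : IsFerrandPushout (closedSub (α ⟨s(u, v), huv⟩) ≫ ι ⟨v, hv⟩)
        (closedSub (α ⟨s(u, v), huv⟩)) a b)
      (κ : (H ⊔ G.subgraphOfAdj huv).verts → (Spec (CommRingCat.of R) ⟶ W))
      (hκ : ∀ w : H.verts, κ ⟨w, Or.inl w.2⟩ = ι w ≫ a)
      (hκu : κ ⟨u, Or.inr (Or.inl rfl)⟩ = b) :
      IsGluing G α (H ⊔ G.subgraphOfAdj huv) W κ
  | chord (H : G.Subgraph) (X : Scheme.{u}) (ι : H.verts → (Spec (CommRingCat.of R) ⟶ X))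
      (hX : IsGluing G α H X ι)
      (u v : V) (huv : G.Adj u v) (hu : u ∈ H.verts) (hv : v ∈ H.verts) (hH : ¬ H.Adj u v)
      (W : Scheme.{u}) (hW : IsAffine W) (q : X ⟶ W)
      (hi : IsClosedImmersion (closedSub (α ⟨s(u, v), huv⟩) ≫ ι ⟨u, hu⟩))
      (hj : IsClosedImmersion (closedSub (α ⟨s(u, v), huv⟩) ≫ ι ⟨v, hv⟩))
      (hq : (closedSub (α ⟨s(u, v), huv⟩) ≫ ι ⟨u, hu⟩) ≫ q =
        (closedSub (α ⟨s(u, v), huv⟩) ≫ ι ⟨v, hv⟩) ≫ q)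
      (hcoeq : Nonempty (IsColimit (Cofork.ofπ q hq)))
      (κ : (H ⊔ G.subgraphOfAdj huv).verts → (Spec (CommRingCat.of R) ⟶ W))
      (hκ : ∀ w : H.verts, κ ⟨w, Or.inl w.2⟩ = ι w ≫ q) :
      IsGluing G α (H ⊔ G.subgraphOfAdj huv) W κ

/-- `Spec R_G`, with its canonical copies of `Spec R`, is obtained from one copy of `Spec R` per
vertex of `G` by finitely many Ferrand pushouts or coequalizers, one for each edge of `G`. -/
def SpecObtainedByGluing (G : SimpleGraph V) (α : G.edgeSet → Ideal R) : Prop :=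
  IsGluing G α ⊤ (Spec (CommRingCat.of (splineRing G α))) (fun v => vertexMap G α v)

end Gluing

end GraphSpline

/-! Everything follows from one universal property: a morphism from `Spec R_G` to an arbitrary
scheme `T` is a family of morphisms `f v : Spec R ⟶ T` that agree on `Spec (R / α (uv))` for every
edge (`IsCompatible.exists_desc`, `hom_ext_of_vertexMap`). Since `T` need not be affine, this is
proved on points, topology and sections.

Points: the evaluations have finitely many kernels, with intersection zero, so each prime of `R_G`
comes from some vertex. Two vertices yield the same prime only if a walk joins them whose labels lie
in that prime (`eq_and_reflTransGen_of_vertexMap_eq`), so a compatible family is well defined on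
points. Topology: evaluations are surjective because of the constant splines, so `Spec R_G` is a
finite union of closed copies of `Spec R`, on which continuity can be tested. Sections: `R_G` is a
finite limit of rings and localization commutes with finite limits (`exists_section`).

The two colimit statements translate cocones into compatible families. For the gluing, adding an
edge to a subgraph adds exactly one compatibility condition, which is the condition of a pushout or
of a coequalizer; if `G` is connected, a maximal subgraph reachable in this way is all of `G`. -/

namespace GraphSpline

open Opposite

/-! ### Descent of scheme morphisms along a jointly surjective family. -/

section JointlyEpi

variable {J : Type u} {X : J → Scheme.{u}} {W : Scheme.{u}}

/-- A family of morphisms of schemes that is jointly surjective on points and jointly injective on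
sections over every open set is jointly epimorphic. -/
theorem scheme_hom_ext_of_jointly (p : ∀ j, X j ⟶ W) (hsurj : ∀ w : W, ∃ j, ∃ x : X j, p j x = w)
    (hinj : ∀ (O : W.Opens) (s t : Γ(W, O)), (∀ j, (p j).app O s = (p j).app O t) → s = t)
    {T : Scheme.{u}} {g g' : W ⟶ T} (h : ∀ j, p j ≫ g = p j ≫ g') : g = g' := by
  have hb : g.base = g'.base := by
    refine ConcreteCategory.hom_ext _ _ fun w => ?_
    obtain ⟨j, x, rfl⟩ := hsurj w
    exact congr($(h j) x)
  refine Scheme.Hom.ext hb fun U => ConcreteCategory.hom_ext _ _ fun s => hinj _ _ _ fun j => ?_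
  -- The preimages of `U` under `g` and `g'` are only propositionally equal, so both sides are
  -- compared through `appLE`.
  have h₁ : (g.app U ≫ W.presheaf.map
      (eqToHom congr((TopologicalSpace.Opens.map $hb.symm).obj U)).op) ≫ (p j).app _ =
      (p j ≫ g).appLE U (p j ⁻¹ᵁ g' ⁻¹ᵁ U)
        (by rw [← Scheme.Hom.comp_preimage, h j]) := by
    rw [Scheme.Hom.app_eq_appLE, Scheme.Hom.appLE_map, Scheme.Hom.app_eq_appLE,
      Scheme.Hom.appLE_comp_appLE]
  have h₂ : g'.app U ≫ (p j).app _ =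
      (p j ≫ g').appLE U (p j ⁻¹ᵁ g' ⁻¹ᵁ U) le_rfl := by
    rw [Scheme.Hom.app_eq_appLE, Scheme.Hom.app_eq_appLE, Scheme.Hom.appLE_comp_appLE]
  have h₃ : (p j ≫ g).appLE U (p j ⁻¹ᵁ g' ⁻¹ᵁ U) (by rw [← Scheme.Hom.comp_preimage, h j]) =
      (p j ≫ g').appLE U (p j ⁻¹ᵁ g' ⁻¹ᵁ U) le_rfl := by
    congr 1
    exact h j
  exact congr($(h₁.trans (h₃.trans h₂.symm)) s)

/-- Let `p` be a family of morphisms of schemes to `W` that is jointly surjective on points and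
jointly injective on sections. A compatible family of morphisms to `T` factors through `W` as soon
as it does so on points, continuously, and on sections. -/
theorem exists_scheme_hom_of_jointly (p : ∀ j, X j ⟶ W)
    (hsurj : ∀ w : W, ∃ j, ∃ x : X j, p j x = w)
    (hinj : ∀ (O : W.Opens) (s t : Γ(W, O)), (∀ j, (p j).app O s = (p j).app O t) → s = t)
    {T : Scheme.{u}} (f : ∀ j, X j ⟶ T) (g : W.carrier ⟶ T.carrier)
    (hg : ∀ j, (p j).base ≫ g = (f j).base)
    (hex : ∀ (U : T.Opens) (t : Γ(T, U)), ∃ s : Γ(W, (TopologicalSpace.Opens.map g).obj U),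
      ∀ j, (p j).app _ s = (f j).appLE U (p j ⁻¹ᵁ (TopologicalSpace.Opens.map g).obj U)
        (by rw [← hg j]; rfl) t) :
    ∃ h : W ⟶ T, ∀ j, p j ≫ h = f j := by
  choose c hc using hex
  let c' : ∀ U : T.Opens, Γ(T, U) ⟶ Γ(W, (TopologicalSpace.Opens.map g).obj U) := fun U =>
    CommRingCat.ofHom
      { toFun := c U
        map_one' := hinj _ _ _ fun j => by rw [hc, map_one, map_one]
        map_mul' := fun a b => hinj _ _ _ fun j => by rw [hc, map_mul, map_mul, hc, hc]
        map_zero' := hinj _ _ _ fun j => by rw [hc, map_zero, map_zero]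
        map_add' := fun a b => hinj _ _ _ fun j => by rw [hc, map_add, map_add, hc, hc] }
  have hc' : ∀ (U : T.Opens) (j : J), c' U ≫ (p j).app _ =
      (f j).appLE U (p j ⁻¹ᵁ (TopologicalSpace.Opens.map g).obj U) (by rw [← hg j]; rfl) :=
    fun U j => ConcreteCategory.hom_ext _ _ fun t => hc U t j
  let φ : T.presheaf ⟶ (TopCat.Presheaf.pushforward _ g).obj W.presheaf :=
    { app := fun U => c' U.unop
      naturality := fun U U' i => by
        refine ConcreteCategory.hom_ext _ _ fun t => hinj _ _ _ fun j => ?_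
        have h₁ : (T.presheaf.map i ≫ c' U'.unop) ≫ (p j).app _ = (f j).appLE U.unop
            (p j ⁻¹ᵁ (TopologicalSpace.Opens.map g).obj U'.unop)
            (fun x hx => by rw [← hg j]; exact i.unop.le hx) := by
          rw [Category.assoc, hc']
          exact Scheme.Hom.map_appLE _ _ _
        have h₂ : (c' U.unop ≫
            W.presheaf.map ((TopologicalSpace.Opens.map g).map i.unop).op) ≫ (p j).app _ =
            (f j).appLE U.unop (p j ⁻¹ᵁ (TopologicalSpace.Opens.map g).obj U'.unop)
            (fun x hx => by rw [← hg j]; exact i.unop.le hx) := by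
          rw [Category.assoc, Scheme.Hom.naturality, ← Category.assoc, hc']
          exact Scheme.Hom.appLE_map _ _ _
        exact congr($(h₁.trans h₂.symm) t) }
  let h₀ : W.toPresheafedSpace.Hom T.toPresheafedSpace := ⟨g, φ⟩
  have key : ∀ j, PresheafedSpace.comp (p j).toLRSHom'.toHom h₀ = (f j).toLRSHom'.toHom := by
    intro j
    refine PresheafedSpace.Hom.ext _ _ (hg j) (TopCat.Presheaf.ext fun U => ?_)
    have h₁ := hc' U j
    have h₂ : (f j).app U = (f j).appLE U _ le_rfl := Scheme.Hom.app_eq_appLE _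
    refine Eq.trans ?_ (h₂.symm)
    have h₃ : ∀ i : op (p j ⁻¹ᵁ (TopologicalSpace.Opens.map g).obj U) ⟶ op (f j ⁻¹ᵁ U),
        (c' U ≫ (p j).app _) ≫ (X j).presheaf.map i = (f j).appLE U _ le_rfl := fun i => by
      rw [h₁, Scheme.Hom.appLE_map]
    exact h₃ (homOfLE (by rw [← hg j]; rfl)).op
  -- Followed by the stalk map of `p j`, the stalk map of `h₀` becomes that of `f j` up to an
  -- `eqToHom`. The composite is local, and this forces its first factor to be local.
  have hloc : ∀ w, IsLocalHom (h₀.stalkMap w).hom := by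
    intro w
    obtain ⟨j, x, rfl⟩ := hsurj w
    have h₁ := PresheafedSpace.stalkMap.comp (X := (X j).toPresheafedSpace)
      (p j).toLRSHom'.toHom (show W.toPresheafedSpace ⟶ T.toPresheafedSpace from h₀) x
    have h₂ := PresheafedSpace.stalkMap.congr_hom _ _ (key j) x
    have hE : ∀ {A B C : CommRingCat.{u}} (e : A = B) (k : B ⟶ C), IsLocalHom k.hom →
        IsLocalHom (eqToHom e ≫ k).hom := by
      rintro A _ C rfl k hk
      rwa [eqToHom_refl, Category.id_comp]
    have h₃ : IsLocalHom ((f j).toLRSHom'.toHom.stalkMap x).hom := (f j).toLRSHom'.prop x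
    have h₄ := h₁.symm.trans h₂
    have h₅ : IsLocalHom (h₀.stalkMap (p j x) ≫ (p j).stalkMap x).hom :=
      (congrArg (fun z => IsLocalHom (CommRingCat.Hom.hom z)) h₄).mpr (hE _ _ h₃)
    rw [CommRingCat.hom_comp] at h₅
    exact isLocalHom_of_comp _ ((p j).stalkMap x).hom
  refine ⟨⟨⟨h₀, hloc⟩⟩, fun j => Scheme.Hom.ext' (LocallyRingedSpace.Hom.ext' (key j))⟩

end JointlyEpi

/-! ### Sections over opens of `Spec A`, for `A` a finite limit of rings. -/

section Sections

/-- The basic open subset `D(a)` of `Spec A`. -/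
def specBasicOpen {A : CommRingCat.{u}} (a : A) : (Spec A).Opens := PrimeSpectrum.basicOpen a

instance {A : CommRingCat.{u}} (a : A) : IsLocalization.Away a Γ(Spec A, specBasicOpen a) :=
  StructureSheaf.IsLocalization.to_basicOpen A a

theorem preimage_specBasicOpen {A B : CommRingCat.{u}} (φ : A ⟶ B) (a : A) :
    Spec.map φ ⁻¹ᵁ specBasicOpen a = specBasicOpen (φ a) := rfl

theorem le_iSup_specBasicOpen {A : CommRingCat.{u}} (O : (Spec A).Opens) :
    O ≤ ⨆ a : {a : A // specBasicOpen a ≤ O}, specBasicOpen a.1 := by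
  intro x hx
  obtain ⟨_, ⟨a, rfl⟩, hxa, ha⟩ :=
    (TopologicalSpace.Opens.isBasis_iff_nbhd.1 PrimeSpectrum.isBasis_basic_opens) hx
  exact TopologicalSpace.Opens.mem_iSup.2 ⟨⟨a, ha⟩, hxa⟩

theorem specMap_appLE_algebraMap {A B : CommRingCat.{u}} (φ : A ⟶ B) (U : (Spec A).Opens)
    (V : (Spec B).Opens) (h : V ≤ Spec.map φ ⁻¹ᵁ U) (a : A) :
    (Spec.map φ).appLE U V h (algebraMap A Γ(Spec A, U) a) = algebraMap B Γ(Spec B, V) (φ a) := by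
  have h₁ : (Scheme.ΓSpecIso A).inv ≫ (Spec A).presheaf.map (homOfLE le_top).op ≫
      (Spec.map φ).appLE U V h =
      φ ≫ (Scheme.ΓSpecIso B).inv ≫ (Spec B).presheaf.map (homOfLE le_top).op := by
    rw [Scheme.Hom.map_appLE, Scheme.ΓSpecIso_inv_naturality_assoc, Scheme.Hom.appLE]
    rfl
  simp only [IsAffineOpen.algebraMap_Spec_obj]
  exact congr($h₁ a)

theorem exists_nat_of_finite {ι : Type*} [Finite ι] {P : ι → ℕ → Prop} (h : ∀ i, ∃ n, P i n)
    (hP : ∀ i m n, m ≤ n → P i m → P i n) : ∃ n, ∀ i, P i n := by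
  cases nonempty_fintype ι
  choose n hn using h
  exact ⟨∑ i, n i, fun i => hP i _ _
    (Finset.single_le_sum (fun _ _ => Nat.zero_le _) (Finset.mem_univ i)) (hn i)⟩

/-- Finiteness allows a common exponent for the denominators. -/
theorem exists_mul_pow_eq_of_finite {V : Type u} {A B : V → Type u} [Finite V]
    [∀ v, CommRing (A v)] [∀ v, CommRing (B v)] [∀ v, Algebra (A v) (B v)] (a : ∀ v, A v)
    [∀ v, IsLocalization.Away (a v) (B v)] (z : ∀ v, B v) :
    ∃ (n : ℕ) (r : ∀ v, A v), ∀ v, z v * algebraMap (A v) (B v) (a v) ^ n =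
      algebraMap (A v) (B v) (r v) := by
  obtain ⟨n, hn⟩ := exists_nat_of_finite
    (P := fun v n => ∃ r, z v * algebraMap (A v) (B v) (a v) ^ n = algebraMap (A v) (B v) r)
    (fun v => IsLocalization.Away.surj (a v) (z v)) fun v m n hmn ⟨r, h⟩ =>
      ⟨r * a v ^ (n - m), by rw [map_mul, ← h, map_pow, mul_assoc, ← pow_add,
        Nat.add_sub_cancel' hmn]⟩
  choose r hr using hn
  exact ⟨n, r, hr⟩

variable {V : Type u} [Finite V] {A : CommRingCat.{u}} {B : V → CommRingCat.{u}}
  (φ : ∀ v, A ⟶ B v)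

/-- Restriction of a section over `D(a)` to finitely many `Spec B v` is injective if `A → ∏ B v`
is injective. -/
theorem section_basicOpen_ext (hφ : ∀ x : A, (∀ v, φ v x = 0) → x = 0) (a : A)
    (s t : Γ(Spec A, specBasicOpen a))
    (h : ∀ v, (Spec.map (φ v)).app _ s = (Spec.map (φ v)).app _ t) : s = t := by
  rw [← sub_eq_zero]
  replace h : ∀ v, (Spec.map (φ v)).app _ (s - t) = 0 := fun v => by rw [map_sub, h, sub_self]
  generalize s - t = s at h
  obtain ⟨n, x, hx⟩ := IsLocalization.Away.surj a s
  have hv : ∀ v, ∃ n : ℕ, φ v a ^ n * φ v x = 0 := by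
    intro v
    have h₁ : algebraMap (B v) Γ(Spec (B v), specBasicOpen (φ v a)) (φ v x) =
        algebraMap (B v) Γ(Spec (B v), specBasicOpen (φ v a)) 0 := by
      have h₂ := specMap_appLE_algebraMap (φ v)
        (specBasicOpen a) (specBasicOpen (φ v a)) le_rfl x
      have h₃ : (Spec.map (φ v)).appLE (specBasicOpen a)
          (specBasicOpen (φ v a)) le_rfl s = 0 := by
        exact congr($(Scheme.Hom.appLE_eq_app (Spec.map (φ v))) s).trans (h v)
      rw [← hx, map_mul, h₃, zero_mul] at h₂
      rw [map_zero, h₂]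
    obtain ⟨n, hn⟩ := IsLocalization.Away.exists_of_eq (φ v a) h₁
    exact ⟨n, by simpa using hn⟩
  obtain ⟨m, hm⟩ := exists_nat_of_finite hv fun v m n hmn h => by
    rw [← Nat.sub_add_cancel hmn, pow_add, mul_assoc, h, mul_zero]
  have h₀ : a ^ m * x = 0 := hφ _ fun v => by rw [map_mul, map_pow, hm]
  have hu := IsLocalization.Away.algebraMap_isUnit (S := Γ(Spec A, specBasicOpen a)) a
  refine (hu.pow (n + m)).mul_left_eq_zero.1 ?_
  rw [pow_add, ← mul_assoc, hx, ← map_pow, ← map_mul, mul_comm, h₀, map_zero]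

theorem section_ext (hφ : ∀ x : A, (∀ v, φ v x = 0) → x = 0) (O : (Spec A).Opens)
    (s t : Γ(Spec A, O)) (h : ∀ v, (Spec.map (φ v)).app _ s = (Spec.map (φ v)).app _ t) :
    s = t := by
  refine (Spec A).sheaf.eq_of_locally_eq' (fun a : {a : A // specBasicOpen a ≤ O} =>
    specBasicOpen a.1) O (fun a => homOfLE a.2) (le_iSup_specBasicOpen O) _ _ fun a =>
      section_basicOpen_ext φ hφ a.1 _ _ fun v => ?_
  have h₁ := Scheme.Hom.naturality (Spec.map (φ v)) (homOfLE a.2).op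
  have h₂ := congr($h₁ s)
  rw [CommRingCat.comp_apply, CommRingCat.comp_apply, h v] at h₂
  exact h₂.trans congr($h₁ t).symm

variable {E : Type u} {l r : E → V} {C : E → CommRingCat.{u}}
  (lm : ∀ e, B (l e) ⟶ C e) (rm : ∀ e, B (r e) ⟶ C e)

/-- The sections `s v` over the preimages of `O` agree on all the `Spec (C e)`. -/
def SectionsCompatible (O : (Spec A).Opens) (s : ∀ v, Γ(Spec (B v), Spec.map (φ v) ⁻¹ᵁ O)) :
    Prop :=
  ∀ (e : E) (O' : (Spec (C e)).Opens) (h₁ : O' ≤ Spec.map (lm e) ⁻¹ᵁ Spec.map (φ (l e)) ⁻¹ᵁ O)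
    (h₂ : O' ≤ Spec.map (rm e) ⁻¹ᵁ Spec.map (φ (r e)) ⁻¹ᵁ O),
    (Spec.map (lm e)).appLE _ O' h₁ (s (l e)) = (Spec.map (rm e)).appLE _ O' h₂ (s (r e))

/-- Localization at `a` commutes with the finite limit: clear denominators by `a ^ n`, force the
numerators to agree on every `C e` by a further `a ^ m`, lift them to `x : A`, and divide `x` by `a
^ (m + n)`. -/
theorem exists_section_basicOpen [Finite E] (hw : ∀ e, φ (l e) ≫ lm e = φ (r e) ≫ rm e)
    (hex : ∀ b : ∀ v, B v, (∀ e, lm e (b (l e)) = rm e (b (r e))) → ∃ x : A, ∀ v, φ v x = b v)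
    (a : A) (s : ∀ v, Γ(Spec (B v), Spec.map (φ v) ⁻¹ᵁ specBasicOpen a))
    (hs : SectionsCompatible φ lm rm (specBasicOpen a) s) :
    ∃ t : Γ(Spec A, specBasicOpen a), ∀ v, (Spec.map (φ v)).app _ t = s v := by
  have hloc : ∀ v, IsLocalization.Away (φ v a)
      Γ(Spec (B v), Spec.map (φ v) ⁻¹ᵁ specBasicOpen a) := fun v =>
    inferInstanceAs (IsLocalization.Away (φ v a)
      Γ(Spec (B v), specBasicOpen (φ v a)))
  obtain ⟨n, b, hb⟩ := exists_mul_pow_eq_of_finite (A := fun v => B v) (fun v => φ v a) s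
  have hwa : ∀ e, lm e (φ (l e) a) = rm e (φ (r e) a) := fun e => congr($(hw e) a)
  have he : ∀ e, ∃ m : ℕ, lm e (φ (l e) a) ^ m * lm e (b (l e)) =
      lm e (φ (l e) a) ^ m * rm e (b (r e)) := by
    intro e
    let O' : (Spec (C e)).Opens := specBasicOpen (lm e (φ (l e) a))
    have h₁ : O' ≤ Spec.map (lm e) ⁻¹ᵁ Spec.map (φ (l e)) ⁻¹ᵁ specBasicOpen a := le_rfl
    have h₂ : O' ≤ Spec.map (rm e) ⁻¹ᵁ Spec.map (φ (r e)) ⁻¹ᵁ specBasicOpen a := by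
      rw [preimage_specBasicOpen, preimage_specBasicOpen, ← hwa]
    refine IsLocalization.Away.exists_of_eq (S := Γ(Spec (C e), O')) (lm e (φ (l e) a)) ?_
    rw [← specMap_appLE_algebraMap (lm e) _ O' h₁, ← specMap_appLE_algebraMap (rm e) _ O' h₂,
      ← hb, ← hb, map_mul, map_mul, hs e O' h₁ h₂, map_pow, map_pow, specMap_appLE_algebraMap,
      specMap_appLE_algebraMap, hwa]
  obtain ⟨m, hm⟩ := exists_nat_of_finite he fun e m n hmn h => by
    rw [← Nat.sub_add_cancel hmn, pow_add, mul_assoc, h, mul_assoc]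
  obtain ⟨x, hx⟩ := hex (fun v => φ v a ^ m * b v) fun e => by
    rw [map_mul, map_mul, map_pow, map_pow, hm, hwa]
  have hu := IsLocalization.Away.algebraMap_isUnit (S := Γ(Spec A, specBasicOpen a)) a
  obtain ⟨w, hw'⟩ := hu.pow (m + n)
  refine ⟨algebraMap A _ x * ↑w⁻¹, fun v => ?_⟩
  have hv := IsLocalization.Away.algebraMap_isUnit
    (S := Γ(Spec (B v), Spec.map (φ v) ⁻¹ᵁ specBasicOpen a)) (φ v a)
  refine (hv.pow (m + n)).mul_right_cancel ?_
  have hA : ∀ y : A, (Spec.map (φ v)).app (specBasicOpen a) (algebraMap A _ y) =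
      algebraMap (B v) _ (φ v y) := fun y => by
    rw [Scheme.Hom.app_eq_appLE, specMap_appLE_algebraMap]
  have h₁ : algebraMap (B v) Γ(Spec (B v), Spec.map (φ v) ⁻¹ᵁ specBasicOpen a)
      (φ v a) ^ (m + n) = (Spec.map (φ v)).app (specBasicOpen a) ↑w := by
    rw [hw', map_pow, hA]
  conv_lhs => rw [h₁, ← map_mul, mul_assoc, Units.inv_mul, mul_one, hA, hx, map_mul, map_pow, ← hb]
  ring

theorem exists_section [Finite E] (hw : ∀ e, φ (l e) ≫ lm e = φ (r e) ≫ rm e)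
    (hφ : ∀ x : A, (∀ v, φ v x = 0) → x = 0)
    (hex : ∀ b : ∀ v, B v, (∀ e, lm e (b (l e)) = rm e (b (r e))) → ∃ x : A, ∀ v, φ v x = b v)
    (O : (Spec A).Opens) (s : ∀ v, Γ(Spec (B v), Spec.map (φ v) ⁻¹ᵁ O))
    (hs : SectionsCompatible φ lm rm O s) :
    ∃ t : Γ(Spec A, O), ∀ v, (Spec.map (φ v)).app _ t = s v := by
  let D : {a : A // specBasicOpen a ≤ O} → (Spec A).Opens := fun a => specBasicOpen a.1
  have hD : O ≤ iSup D := le_iSup_specBasicOpen O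
  have hDO : ∀ a, D a ≤ O := fun a => a.2
  have hsD : ∀ a, ∃ t : Γ(Spec A, D a), ∀ v, (Spec.map (φ v)).app _ t =
      (Spec (B v)).presheaf.map ((TopologicalSpace.Opens.map (Spec.map (φ v)).base).map
        (homOfLE (hDO a))).op (s v) := by
    intro a
    refine exists_section_basicOpen φ lm rm hw hex a.1 _ fun e O' h₁ h₂ => ?_
    have h := hs e O' (h₁.trans fun x hx => hDO a hx) (h₂.trans fun x hx => hDO a hx)
    have e₁ := Scheme.Hom.map_appLE (Spec.map (lm e)) h₁
      ((TopologicalSpace.Opens.map (Spec.map (φ (l e))).base).map (homOfLE (hDO a))).op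
    have e₂ := Scheme.Hom.map_appLE (Spec.map (rm e)) h₂
      ((TopologicalSpace.Opens.map (Spec.map (φ (r e))).base).map (homOfLE (hDO a))).op
    exact congr($e₁ (s (l e))).trans (h.trans congr($e₂ (s (r e))).symm)
  choose t ht using hsD
  have hres : ∀ (a) (O' : (Spec A).Opens) (i : O' ⟶ D a) (v : V),
      (Spec.map (φ v)).app O' ((Spec A).presheaf.map i.op (t a)) =
      (Spec (B v)).presheaf.map ((TopologicalSpace.Opens.map (Spec.map (φ v)).base).map
        (homOfLE (i.le.trans (hDO a)))).op (s v) := by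
    intro a O' i v
    have h₁ := Scheme.Hom.naturality (Spec.map (φ v)) i.op
    refine congr($h₁ (t a)).trans ?_
    rw [CommRingCat.comp_apply, ht, ← CommRingCat.comp_apply, ← Functor.map_comp]
    rfl
  -- The local lifts agree on overlaps by `section_ext`, since both restrict to `s v` on each `Spec
  -- (B v)`.
  obtain ⟨x, hx, -⟩ := (Spec A).sheaf.existsUnique_gluing' D O (fun a => homOfLE (hDO a)) hD t
    fun a b => section_ext φ hφ _ _ _ fun v =>
      (hres a _ (TopologicalSpace.Opens.infLELeft _ _) v).trans
        (hres b _ (TopologicalSpace.Opens.infLERight _ _) v).symm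
  refine ⟨x, fun v => (Spec (B v)).sheaf.eq_of_locally_eq' (fun a => Spec.map (φ v) ⁻¹ᵁ D a) _
    (fun a => (TopologicalSpace.Opens.map (Spec.map (φ v)).base).map (homOfLE (hDO a)))
    (fun y hy => ?_) _ _ fun a => ?_⟩
  · obtain ⟨a, ha⟩ := TopologicalSpace.Opens.mem_iSup.1 (hD hy)
    exact TopologicalSpace.Opens.mem_iSup.2 ⟨a, ha⟩
  · have h₁ := Scheme.Hom.naturality (Spec.map (φ v)) (homOfLE (hDO a)).op
    refine (congr($h₁ x).symm).trans ?_
    refine Eq.trans ?_ (ht a v)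
    exact congrArg ((Spec.map (φ v)).app (D a)) (hx a)

end Sections

/-! ### Points, topology and universal property of `Spec R_G`. -/

section Spline

variable {V R : Type u} [CommRing R] (G : SimpleGraph V) (α : G.edgeSet → Ideal R)

/-- The diagonal embedding of `R` into the ring of splines. -/
def constHom : R →+* splineRing G α :=
  (Pi.constRingHom V R).codRestrict (splineRing G α) fun r u v h => by simp

theorem evalHom_surjective (v : V) : Function.Surjective (evalHom G α v) :=
  fun r => ⟨constHom G α r, rfl⟩

instance isClosedImmersion_vertexMap (v : V) : IsClosedImmersion (vertexMap G α v) :=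
  IsClosedImmersion.spec_of_surjective _ (evalHom_surjective G α v)

instance isClosedImmersion_closedSub (I : Ideal R) : IsClosedImmersion (closedSub I) :=
  IsClosedImmersion.spec_of_surjective _ Ideal.Quotient.mk_surjective

theorem exists_closedSub_eq (I : Ideal R) (x : Spec (CommRingCat.of R))
    (h : I ≤ PrimeSpectrum.asIdeal x) : ∃ z, closedSub I z = x := by
  have h₁ : x ∈ Set.range (PrimeSpectrum.comap (Ideal.Quotient.mk I)) := by
    rw [range_comap_of_surjective _ _ Ideal.Quotient.mk_surjective, Ideal.mk_ker]
    exact h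
  exact h₁

/-- A prime containing a finite intersection of ideals contains one of them; here the intersection
of the evaluation kernels is zero. -/
theorem exists_vertexMap_eq [Finite V] (w : Spec (CommRingCat.of (splineRing G α))) :
    ∃ v, ∃ x, vertexMap G α v x = w := by
  cases nonempty_fintype V
  have hw : (PrimeSpectrum.asIdeal w).IsPrime := PrimeSpectrum.isPrime w
  have h₀ : Finset.univ.inf (fun v => RingHom.ker (evalHom G α v)) ≤ PrimeSpectrum.asIdeal w := by
    intro s hs
    rw [show s = 0 from Subtype.ext (funext fun v =>
      Finset.inf_le (f := fun v => RingHom.ker (evalHom G α v)) (Finset.mem_univ v) hs)]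
    exact Ideal.zero_mem _
  obtain ⟨v, -, hv⟩ := hw.inf_le'.1 h₀
  have h₁ : w ∈ Set.range (PrimeSpectrum.comap (evalHom G α v)) := by
    rw [range_comap_of_surjective _ _ (evalHom_surjective G α v)]
    exact hv
  exact ⟨v, h₁⟩

/-- If a prime of `R_G` comes from the prime `x` of the copy of `R` at `u` and from the prime `y`
of the copy at `v`, then `x = y`, and `u` and `v` are joined by a walk all of whose edges have
their labels contained in `x`. -/
theorem eq_and_reflTransGen_of_vertexMap_eq [Finite V] {u v : V} {x y : Spec (CommRingCat.of R)}
    (h : vertexMap G α u x = vertexMap G α v y) :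
    x = y ∧ Relation.ReflTransGen
      (fun a b => ∃ e : G.Adj a b, α ⟨s(a, b), e⟩ ≤ PrimeSpectrum.asIdeal x) u v := by
  classical
  cases nonempty_fintype V
  have hmem : ∀ s : splineRing G α, s.1 u ∈ PrimeSpectrum.asIdeal x ↔
      s.1 v ∈ PrimeSpectrum.asIdeal y := fun s =>
    iff_of_eq congr(s ∈ PrimeSpectrum.asIdeal $h)
  refine ⟨PrimeSpectrum.ext (Ideal.ext fun r => hmem (constHom G α r)), ?_⟩
  have hx : (PrimeSpectrum.asIdeal x).IsPrime := PrimeSpectrum.isPrime x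
  by_contra hv
  set ρ : V → V → Prop := fun a b =>
    ∃ e : G.Adj a b, α ⟨s(a, b), e⟩ ≤ PrimeSpectrum.asIdeal x with hρ
  -- For each edge whose label is not contained in `x`, pick an element of the label outside `x`.
  -- The product of all choices is still outside the prime `x`.
  have hc : ∀ i : V × V, ∃ c : R, c ∉ PrimeSpectrum.asIdeal x ∧
      ∀ e : G.Adj i.1 i.2, ¬ ρ i.1 i.2 → c ∈ α ⟨s(i.1, i.2), e⟩ := by
    intro i
    by_cases hi : ∃ e : G.Adj i.1 i.2, ¬ α ⟨s(i.1, i.2), e⟩ ≤ PrimeSpectrum.asIdeal x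
    · obtain ⟨e, he⟩ := hi
      obtain ⟨c, hc, hcx⟩ := SetLike.not_le_iff_exists.1 he
      exact ⟨c, hcx, fun _ _ => hc⟩
    · push Not at hi
      -- Nothing is asked of `c` for this pair, so the harmless factor `1` serves.
      exact ⟨1, fun h1 => hx.ne_top ((Ideal.eq_top_iff_one _).2 h1),
        fun e he => (he ⟨e, hi e⟩).elim⟩
  choose c hcx hcα using hc
  have hprod : ∏ i, c i ∉ PrimeSpectrum.asIdeal x := fun hp => by
    obtain ⟨i, -, hi⟩ := hx.prod_mem_iff.1 hp
    exact hcx i hi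
  have hout : ∀ a b (e : G.Adj a b), Relation.ReflTransGen ρ u a →
      ¬ Relation.ReflTransGen ρ u b → ∏ i, c i ∈ α ⟨s(a, b), e⟩ := fun a b e ha hb =>
    Ideal.mem_of_dvd _ (Finset.dvd_prod_of_mem c (Finset.mem_univ (a, b)))
      (hcα (a, b) e fun hab => hb (ha.tail hab))
  -- The separating spline: its jumps occur only along edges leaving the set reachable from `u`, and
  -- the product lies in their labels. Its value at `u` is outside `x`, while its value at `v` is
  -- zero.
  let s : splineRing G α := ⟨fun w => if Relation.ReflTransGen ρ u w then ∏ i, c i else 0, by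
    intro a b e
    by_cases ha : Relation.ReflTransGen ρ u a <;> by_cases hb : Relation.ReflTransGen ρ u b
    · simp [ha, hb]
    · simpa [ha, hb] using hout a b e ha hb
    · have h₁ := hout b a e.symm hb ha
      have h₂ : (⟨s(b, a), e.symm⟩ : G.edgeSet) = ⟨s(a, b), e⟩ := Subtype.ext Sym2.eq_swap
      rw [h₂] at h₁
      simpa [ha, hb] using h₁
    · simp [ha, hb]⟩
  have hsu : s.1 u = ∏ i, c i := if_pos Relation.ReflTransGen.refl
  have hsv : s.1 v = 0 := if_neg hv
  refine hprod ?_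
  rw [← hsu, hmem, hsv]
  exact Ideal.zero_mem _

variable {T : Scheme.{u}}

/-- The morphisms `f v : Spec R ⟶ T` agree on `Spec (R / α (uv))` for all edges `uv` of `G`. -/
def IsCompatible (f : V → (Spec (CommRingCat.of R) ⟶ T)) : Prop :=
  ∀ (u v : V) (h : G.Adj u v),
    closedSub (α ⟨s(u, v), h⟩) ≫ f u = closedSub (α ⟨s(u, v), h⟩) ≫ f v

theorem isCompatible_vertexMap : IsCompatible G α (vertexMap G α) := by
  intro u v h
  have h₁ : CommRingCat.ofHom (evalHom G α u) ≫
      CommRingCat.ofHom (Ideal.Quotient.mk (α ⟨s(u, v), h⟩)) =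
      CommRingCat.ofHom (evalHom G α v) ≫
      CommRingCat.ofHom (Ideal.Quotient.mk (α ⟨s(u, v), h⟩)) :=
    CommRingCat.hom_ext (RingHom.ext fun s => Ideal.Quotient.eq.2 (s.2 u v h))
  have h₂ := congrArg Spec.map h₁
  rwa [Spec.map_comp, Spec.map_comp] at h₂

variable [Finite V]

theorem spline_section_ext (O : (Spec (CommRingCat.of (splineRing G α))).Opens)
    (s t : Γ(Spec (CommRingCat.of (splineRing G α)), O))
    (h : ∀ v, (vertexMap G α v).app O s = (vertexMap G α v).app O t) : s = t :=
  section_ext (fun v => CommRingCat.ofHom (evalHom G α v))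
    (fun _ hx => Subtype.ext (funext hx)) O s t h

theorem hom_ext_of_vertexMap {g g' : Spec (CommRingCat.of (splineRing G α)) ⟶ T}
    (h : ∀ v, vertexMap G α v ≫ g = vertexMap G α v ≫ g') : g = g' :=
  scheme_hom_ext_of_jointly (vertexMap G α) (exists_vertexMap_eq G α) (spline_section_ext G α) h

variable {G α}

theorem IsCompatible.eq_of_vertexMap_eq {f : V → (Spec (CommRingCat.of R) ⟶ T)}
    (hf : IsCompatible G α f) {u v : V} {x y : Spec (CommRingCat.of R)}
    (h : vertexMap G α u x = vertexMap G α v y) : f u x = f v y := by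
  obtain ⟨rfl, h'⟩ := eq_and_reflTransGen_of_vertexMap_eq G α h
  clear h
  induction h' with
  | refl => rfl
  | tail _ hab ih =>
    obtain ⟨e, he⟩ := hab
    obtain ⟨z, rfl⟩ := exists_closedSub_eq _ _ he
    exact ih.trans congr($(hf _ _ e) z)

/-- The preimage of a closed set is a finite union of images of closed sets under the closed maps
`vertexMap G α u`. -/
theorem IsCompatible.exists_continuous {f : V → (Spec (CommRingCat.of R) ⟶ T)}
    (hf : IsCompatible G α f) :
    ∃ g : (Spec (CommRingCat.of (splineRing G α))).carrier ⟶ T.carrier,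
      ∀ v, (vertexMap G α v).base ≫ g = (f v).base := by
  choose v x hx using exists_vertexMap_eq G α
  have hg : ∀ u y, f (v (vertexMap G α u y)) (x (vertexMap G α u y)) = f u y := fun u y =>
    hf.eq_of_vertexMap_eq (hx _)
  refine ⟨TopCat.ofHom ⟨fun w => f (v w) (x w), continuous_iff_isClosed.2 fun Z hZ => ?_⟩,
    fun u => ConcreteCategory.hom_ext _ _ fun y => hg u y⟩
  have h₁ : (fun w => f (v w) (x w)) ⁻¹' Z = ⋃ u, vertexMap G α u '' (f u ⁻¹' Z) := by
    ext w
    simp only [Set.mem_preimage, Set.mem_iUnion, Set.mem_image]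
    refine ⟨fun hw => ⟨v w, x w, hw, hx w⟩, ?_⟩
    rintro ⟨u, y, hy, rfl⟩
    rwa [hg]
  exact (congrArg IsClosed h₁).mpr <| isClosed_iUnion_of_finite fun u =>
    (vertexMap G α u).isClosedEmbedding.isClosedMap _ (hZ.preimage (f u).continuous)

/-- The universal property of `Spec R_G`. -/
theorem IsCompatible.exists_desc {f : V → (Spec (CommRingCat.of R) ⟶ T)}
    (hf : IsCompatible G α f) :
    ∃ g : Spec (CommRingCat.of (splineRing G α)) ⟶ T, ∀ v, vertexMap G α v ≫ g = f v := by
  obtain ⟨g, hg⟩ := hf.exists_continuous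
  refine exists_scheme_hom_of_jointly (vertexMap G α) (exists_vertexMap_eq G α)
    (spline_section_ext G α) f g hg fun U t => ?_
  let E := {i : V × V // G.Adj i.1 i.2}
  refine exists_section (E := E) (l := fun e => e.1.1) (r := fun e => e.1.2)
    (C := fun e => CommRingCat.of (R ⧸ α ⟨s(e.1.1, e.1.2), e.2⟩))
    (fun v => CommRingCat.ofHom (evalHom G α v))
    (fun e => CommRingCat.ofHom (Ideal.Quotient.mk _))
    (fun e => CommRingCat.ofHom (Ideal.Quotient.mk _))
    (fun e => CommRingCat.hom_ext (RingHom.ext fun s => Ideal.Quotient.eq.2 (s.2 _ _ e.2)))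
    (fun _ hx => Subtype.ext (funext hx))
    (fun b hb => ⟨⟨b, fun u v h => Ideal.Quotient.eq.1 (hb ⟨(u, v), h⟩)⟩, fun _ => rfl⟩) _ _ ?_
  intro e O' h₁ h₂
  have hf' := hf _ _ e.2
  have e₁ := Scheme.Hom.appLE_comp_appLE (closedSub (α ⟨s(e.1.1, e.1.2), e.2⟩)) (f e.1.1) U _ O'
    (by rw [← hg]; rfl) h₁
  have e₂ := Scheme.Hom.appLE_comp_appLE (closedSub (α ⟨s(e.1.1, e.1.2), e.2⟩)) (f e.1.2) U _ O'
    (by rw [← hg]; rfl) h₂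
  have e₃ : ∀ {k k' : Spec (CommRingCat.of (R ⧸ α ⟨s(e.1.1, e.1.2), e.2⟩)) ⟶ T} (_ : k = k')
      (h : O' ≤ k ⁻¹ᵁ U) (h' : O' ≤ k' ⁻¹ᵁ U), k.appLE U O' h = k'.appLE U O' h' := by
    rintro k _ rfl _ _; rfl
  exact congr($(e₁.trans ((e₃ hf' _ _).trans e₂.symm)) t)

end Spline

/-! ### The spline diagram and the connected components. -/

section Colimits

variable {V R : Type u} [CommRing R] (G : SimpleGraph V) (α : G.edgeSet → Ideal R)

theorem isCompatible_cocone (s : Cocone (schemeDiagram G α)) :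
    IsCompatible G α fun v => s.ι.app (Opposite.op (Shape.vertex v)) := by
  intro u v h
  have h₁ : ∀ w (hw : w ∈ s(u, v)), closedSub (α ⟨s(u, v), h⟩) ≫
      s.ι.app (Opposite.op (Shape.vertex w)) =
      s.ι.app (Opposite.op (Shape.edge ⟨s(u, v), h⟩)) := fun w hw =>
    s.w (Quiver.Hom.op (Shape.Hom.incidence w ⟨s(u, v), h⟩ hw))
  exact (h₁ u (Sym2.mem_mk_left u v)).trans (h₁ v (Sym2.mem_mk_right u v)).symm

theorem nonempty_isColimit_schemeCocone [Finite V] : Nonempty (IsColimit (schemeCocone G α)) := by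
  choose d hd using fun s : Cocone (schemeDiagram G α) => (isCompatible_cocone G α s).exists_desc
  refine ⟨{ desc := d, fac := fun s j => ?_, uniq := fun s m hm => ?_ }⟩
  · induction j using Opposite.rec with | op j => ?_
    cases j with
    | vertex v => exact hd s v
    | edge e =>
      -- An edge leg is determined by the vertex leg at either endpoint.
      let i : (Shape.vertex (e : Sym2 V).out.1 : Shape G) ⟶ Shape.edge e :=
        Shape.Hom.incidence _ e (Sym2.out_fst_mem _)
      rw [← s.w i.op, ← (schemeCocone G α).w i.op]
      exact (Category.assoc _ _ _).trans (congrArg _ (hd s _))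
  · exact hom_ext_of_vertexMap G α fun v =>
      (hm (Opposite.op (Shape.vertex v))).trans (hd s v).symm

theorem vertexMap_comp_restrictHom (c : G.ConnectedComponent) (v : c) :
    vertexMap c.toSimpleGraph (pullbackLabel c.toSimpleGraph_hom α) v ≫
      Spec.map (CommRingCat.ofHom (restrictHom c.toSimpleGraph_hom α)) = vertexMap G α v :=
  (Spec.map_comp _ _).symm

theorem nonempty_isColimit_components [Finite V] :
    Nonempty (IsColimit (Cofan.mk (Spec (CommRingCat.of (splineRing G α)))
      (fun c : G.ConnectedComponent =>
        Spec.map (CommRingCat.ofHom (restrictHom c.toSimpleGraph_hom α))))) := by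
  let F : G.ConnectedComponent → Scheme.{u} := fun c => Spec (CommRingCat.of
    (splineRing c.toSimpleGraph (pullbackLabel c.toSimpleGraph_hom α)))
  let f : ∀ (s : Cofan F) (c : G.ConnectedComponent), c → (Spec (CommRingCat.of R) ⟶ s.pt) :=
    fun s c v => vertexMap c.toSimpleGraph (pullbackLabel c.toSimpleGraph_hom α) v ≫ s.inj c
  have hf : ∀ s : Cofan F, IsCompatible G α fun v => f s (G.connectedComponentMk v) ⟨v, rfl⟩ := by
    intro s u v h
    have hc : G.connectedComponentMk u = G.connectedComponentMk v :=
      SimpleGraph.ConnectedComponent.connectedComponentMk_eq_of_adj h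
    -- Both endpoints must be viewed in the same component before its compatibility can be used.
    have h₁ : f s (G.connectedComponentMk v) ⟨v, rfl⟩ = f s (G.connectedComponentMk u)
        ⟨v, hc.symm⟩ := by
      generalize G.connectedComponentMk u = c at hc
      subst hc
      rfl
    have h₂ := isCompatible_vertexMap (G.connectedComponentMk u).toSimpleGraph
      (pullbackLabel (G.connectedComponentMk u).toSimpleGraph_hom α) ⟨u, rfl⟩ ⟨v, hc.symm⟩ h
    have h₃ := congrArg (· ≫ s.inj (G.connectedComponentMk u)) h₂
    simp only [Category.assoc] at h₃
    exact h₃.trans (congrArg (closedSub (α ⟨s(u, v), h⟩) ≫ ·) h₁.symm)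
  choose d hd using fun s : Cofan F => (hf s).exists_desc
  refine ⟨Cofan.IsColimit.mk _ d (fun s c => ?_) fun s m hm => ?_⟩
  · refine hom_ext_of_vertexMap _ _ fun v => ?_
    obtain ⟨v, rfl⟩ := v
    exact (congrArg (· ≫ d s) (vertexMap_comp_restrictHom G α _ ⟨v, rfl⟩)).trans (hd s v)
  · refine hom_ext_of_vertexMap G α fun v => (Eq.trans ?_ (hd s v).symm)
    rw [← vertexMap_comp_restrictHom G α (G.connectedComponentMk v) ⟨v, rfl⟩, Category.assoc]
    exact congrArg _ (hm _)

end Colimits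

/-! ### Building `Spec R_G` edge by edge. -/

section Gluing

variable {V R : Type u} [CommRing R] {G : SimpleGraph V} (α : G.edgeSet → Ideal R)

/-- The edge labeling restricted to a subgraph. -/
abbrev subgraphLabel (H : G.Subgraph) : H.coe.edgeSet → Ideal R := pullbackLabel H.hom α

/-- `W` is the universal scheme with a compatible family of copies of `Spec R` indexed by the
vertices of the subgraph `H`. -/
structure IsUniversal (H : G.Subgraph) (W : Scheme.{u})
    (κ : H.verts → (Spec (CommRingCat.of R) ⟶ W)) : Prop where
  isCompatible : IsCompatible H.coe (subgraphLabel α H) κ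
  exists_desc {T : Scheme.{u}} {f : H.verts → (Spec (CommRingCat.of R) ⟶ T)} :
    IsCompatible H.coe (subgraphLabel α H) f → ∃ g : W ⟶ T, ∀ v, κ v ≫ g = f v
  hom_ext {T : Scheme.{u}} {g g' : W ⟶ T} : (∀ v, κ v ≫ g = κ v ≫ g') → g = g'

theorem isUniversal_vertexMap [Finite V] (H : G.Subgraph) :
    IsUniversal α H _ (vertexMap H.coe (subgraphLabel α H)) where
  isCompatible := isCompatible_vertexMap _ _
  exists_desc hf := hf.exists_desc
  hom_ext h := hom_ext_of_vertexMap _ _ h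

variable {α}

theorem isCompatible_sup_subgraphOfAdj {H : G.Subgraph} {u v : V} {huv : G.Adj u v}
    {T : Scheme.{u}} {f : (H ⊔ G.subgraphOfAdj huv).verts → (Spec (CommRingCat.of R) ⟶ T)} :
    IsCompatible _ (subgraphLabel α (H ⊔ G.subgraphOfAdj huv)) f ↔
      IsCompatible _ (subgraphLabel α H) (fun w => f ⟨w, Or.inl w.2⟩) ∧
      closedSub (α ⟨s(u, v), huv⟩) ≫ f ⟨u, Or.inr (Or.inl rfl)⟩ =
        closedSub (α ⟨s(u, v), huv⟩) ≫ f ⟨v, Or.inr (Or.inr rfl)⟩ := by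
  refine ⟨fun hf => ⟨fun a b h => hf ⟨a, Or.inl a.2⟩ ⟨b, Or.inl b.2⟩ (Or.inl h),
    hf ⟨u, Or.inr (Or.inl rfl)⟩ ⟨v, Or.inr (Or.inr rfl)⟩ (Or.inr rfl)⟩, fun hf => ?_⟩
  rintro ⟨a, ha⟩ ⟨b, hb⟩ (h | h)
  · exact hf.1 ⟨a, H.edge_vert h⟩ ⟨b, H.edge_vert h.symm⟩ h
  · have h' : s(u, v) = s(a, b) := h
    rcases Sym2.eq_iff.1 h' with ⟨rfl, rfl⟩ | ⟨rfl, rfl⟩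
    · exact hf.2
    · have h₁ : subgraphLabel α (H ⊔ G.subgraphOfAdj huv) ⟨s(⟨v, ha⟩, ⟨u, hb⟩), Or.inr h⟩ =
          α ⟨s(u, v), huv⟩ := congrArg α (Subtype.ext Sym2.eq_swap)
      exact h₁ ▸ hf.2.symm

variable (α) in
/-- Every affine scheme with the universal property for `H` is obtained by gluing. -/
def GluesTo (H : G.Subgraph) : Prop :=
  ∀ (W : Scheme.{u}) (κ : H.verts → (Spec (CommRingCat.of R) ⟶ W)), IsAffine W →
    IsUniversal α H W κ → IsGluing G α H W κ

/-- With one vertex and no edges, the universal property is that of `Spec R` itself; the family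
consisting of the identity yields the inverse of `ι w`. -/
theorem gluesTo_singleton (v : V) : GluesTo α (G.singletonSubgraph v) := by
  intro W κ _ hκ
  refine IsGluing.vertex v W κ fun w => ?_
  have hw : ∀ w', w' = w := fun w' => Subtype.ext (w'.2.trans w.2.symm)
  obtain ⟨g, hg⟩ := hκ.exists_desc (f := fun _ => 𝟙 (Spec (CommRingCat.of R)))
    fun a b h => rfl
  exact ⟨g, hg w, hκ.hom_ext fun w' => by rw [hw w', reassoc_of% (hg w), Category.comp_id]⟩

theorem GluesTo.pendant [Finite V] {H : G.Subgraph} (hH : GluesTo α H) {u v : V}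
    (huv : G.Adj u v) (hu : u ∉ H.verts) (hv : v ∈ H.verts) :
    GluesTo α (H ⊔ G.subgraphOfAdj huv) := by
  classical
  intro W κ hW hκ
  have hX := isUniversal_vertexMap α H
  have hκ' := isCompatible_sup_subgraphOfAdj.1 hκ.isCompatible
  obtain ⟨a, ha⟩ := hX.exists_desc hκ'.1
  have hw : (closedSub (α ⟨s(u, v), huv⟩) ≫ vertexMap H.coe (subgraphLabel α H) ⟨v, hv⟩) ≫ a =
      closedSub (α ⟨s(u, v), huv⟩) ≫ κ ⟨u, Or.inr (Or.inl rfl)⟩ := by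
    rw [Category.assoc, ha]
    exact hκ'.2.symm
  have hd : ∀ s : PushoutCocone
      (closedSub (α ⟨s(u, v), huv⟩) ≫ vertexMap H.coe (subgraphLabel α H) ⟨v, hv⟩)
      (closedSub (α ⟨s(u, v), huv⟩)), ∃ g : W ⟶ s.pt, a ≫ g = s.inl ∧
        κ ⟨u, Or.inr (Or.inl rfl)⟩ ≫ g = s.inr := by
    intro s
    -- As `v` is in `H`, the only vertex falling into the `else` branch is `u`.
    obtain ⟨g, hg⟩ := hκ.exists_desc (f := fun w => if hw : w.1 ∈ H.verts then
      vertexMap H.coe (subgraphLabel α H) ⟨w, hw⟩ ≫ s.inl else s.inr) <| by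
        refine isCompatible_sup_subgraphOfAdj.2 ⟨fun x y h => ?_, ?_⟩
        · have h₁ := isCompatible_vertexMap H.coe (subgraphLabel α H) x y h
          simp only [Subtype.coe_prop, dite_true]
          exact (Category.assoc _ _ _).symm.trans
            ((congrArg (· ≫ s.inl) h₁).trans (Category.assoc _ _ _))
        · simp only [hu, hv, dite_true, dite_false]
          rw [← s.condition, Category.assoc]
    refine ⟨g, hX.hom_ext fun w => ?_, (hg _).trans (dif_neg hu)⟩
    rw [reassoc_of% (ha w), hg]
    exact dif_pos w.2
  choose d hd₁ hd₂ using hd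
  -- The scheme being extended is the spectrum of the spline ring of `H`. It is affine, so `⊤`
  -- settles the fibre condition.
  refine IsGluing.pendant H _ _ (hH _ _ inferInstance hX) u v huv hu hv W hW a
    (κ ⟨u, Or.inr (Or.inl rfl)⟩) inferInstance inferInstance ⟨⟨⟨hw⟩, ⟨?_⟩⟩, inferInstance,
      inferInstance, fun y => ⟨⊤, isAffineOpen_top _, fun _ _ => trivial⟩⟩ κ
    (fun w => (ha w).symm) rfl
  refine PushoutCocone.IsColimit.mk _ d hd₁ hd₂ fun s m hm₁ hm₂ => hκ.hom_ext ?_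
  rintro ⟨w, hw | rfl | rfl⟩
  · rw [← ha ⟨w, hw⟩, Category.assoc, Category.assoc, hm₁, hd₁]
  · rw [hm₂, hd₂]
  · rw [← ha ⟨w, hv⟩, Category.assoc, Category.assoc, hm₁, hd₁]

/-- No vertex is added, so families on both subgraphs coincide and the sole new compatibility
condition is the coequalizer equation. -/
theorem GluesTo.chord [Finite V] {H : G.Subgraph} (hH : GluesTo α H) {u v : V}
    (huv : G.Adj u v) (hu : u ∈ H.verts) (hv : v ∈ H.verts) (hHuv : ¬ H.Adj u v) :
    GluesTo α (H ⊔ G.subgraphOfAdj huv) := by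
  intro W κ hW hκ
  have hmem : ∀ w ∈ (H ⊔ G.subgraphOfAdj huv).verts, w ∈ H.verts := by
    rintro w (hw | rfl | rfl) <;> assumption
  have hX := isUniversal_vertexMap α H
  have hκ' := isCompatible_sup_subgraphOfAdj.1 hκ.isCompatible
  obtain ⟨q, ha⟩ := hX.exists_desc hκ'.1
  have hq : (closedSub (α ⟨s(u, v), huv⟩) ≫ vertexMap H.coe (subgraphLabel α H) ⟨u, hu⟩) ≫ q =
      (closedSub (α ⟨s(u, v), huv⟩) ≫ vertexMap H.coe (subgraphLabel α H) ⟨v, hv⟩) ≫ q := by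
    rw [Category.assoc, ha, Category.assoc, ha]
    exact hκ'.2
  have hd : ∀ s : Cofork
      (closedSub (α ⟨s(u, v), huv⟩) ≫ vertexMap H.coe (subgraphLabel α H) ⟨u, hu⟩)
      (closedSub (α ⟨s(u, v), huv⟩) ≫ vertexMap H.coe (subgraphLabel α H) ⟨v, hv⟩),
      ∃ g : W ⟶ s.pt, q ≫ g = s.π := by
    intro s
    obtain ⟨g, hg⟩ := hκ.exists_desc (f := fun w =>
      vertexMap H.coe (subgraphLabel α H) ⟨w, hmem w w.2⟩ ≫ s.π) <| by
        refine isCompatible_sup_subgraphOfAdj.2 ⟨fun x y h => ?_, ?_⟩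
        · have h₁ := isCompatible_vertexMap H.coe (subgraphLabel α H) x y h
          exact (Category.assoc _ _ _).symm.trans
            ((congrArg (· ≫ s.π) h₁).trans (Category.assoc _ _ _))
        · exact (Category.assoc _ _ _).symm.trans (s.condition.trans (Category.assoc _ _ _))
    exact ⟨g, hX.hom_ext fun w => by rw [reassoc_of% (ha w), hg]⟩
  choose d hd using hd
  refine IsGluing.chord H _ _ (hH _ _ inferInstance hX) u v huv hu hv hHuv W hW q
    inferInstance inferInstance hq ⟨Cofork.IsColimit.mk _ d hd fun s m hm => hκ.hom_ext ?_⟩ κ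
    fun w => (ha w).symm
  rintro ⟨w, hw⟩
  rw [← ha ⟨w, hmem w hw⟩, Category.assoc, Category.assoc, hd]
  exact congrArg _ hm

theorem gluesTo_top [Finite V] (hG : G.Connected) : GluesTo α (⊤ : G.Subgraph) := by
  obtain ⟨v₀⟩ := hG.nonempty
  -- Maximality replaces an induction on edges: an edge touching `H` but missing from it could be
  -- added by one of the two steps.
  obtain ⟨H, ⟨hv₀, hH⟩, hmax⟩ := Set.Finite.exists_maximal
    (Set.toFinite {H : G.Subgraph | v₀ ∈ H.verts ∧ GluesTo α H})
    ⟨G.singletonSubgraph v₀, rfl, gluesTo_singleton v₀⟩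
  have hadj : ∀ u v, v ∈ H.verts → G.Adj u v → H.Adj u v := by
    intro u v hv huv
    by_contra hHuv
    have h : GluesTo α (H ⊔ G.subgraphOfAdj huv) := by
      by_cases hu : u ∈ H.verts
      · exact hH.chord huv hu hv hHuv
      · exact hH.pendant huv hu hv
    have hle : H ⊔ G.subgraphOfAdj huv ≤ H := hmax ⟨Set.mem_union_left _ hv₀, h⟩ le_sup_left
    exact hHuv (hle.2 (Or.inr rfl))
  have hwalk : ∀ {u v : V}, G.Walk u v → v ∈ H.verts → u ∈ H.verts := by
    intro u v p hv
    induction p with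
    | nil => exact hv
    | cons h _ ih => exact H.edge_vert (hadj _ _ (ih hv) h)
  have hverts : ∀ v, v ∈ H.verts := fun v =>
    (hG.preconnected v v₀).elim fun p => hwalk p hv₀
  have hT : H = ⊤ := SimpleGraph.Subgraph.ext (Set.eq_univ_of_forall hverts)
    (funext fun u => funext fun v => propext ⟨fun h => H.adj_sub h, hadj u v (hverts v)⟩)
  exact hT ▸ hH

/-- The vertices of `⊤` form a subtype of `V`. Since gluing was proved for every affine scheme with
the universal property, no comparison of `R_G` with the spline ring of `⊤.coe` is needed. -/
theorem isUniversal_top [Finite V] :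
    IsUniversal α ⊤ (Spec (CommRingCat.of (splineRing G α))) (fun v => vertexMap G α v) where
  isCompatible := fun u v h => isCompatible_vertexMap G α u v h
  exists_desc {T} f hf := by
    have hf' : IsCompatible G α fun v => f ⟨v, trivial⟩ := fun u v h =>
      hf ⟨u, trivial⟩ ⟨v, trivial⟩ h
    obtain ⟨g, hg⟩ := hf'.exists_desc
    exact ⟨g, fun v => hg v⟩
  hom_ext h := hom_ext_of_vertexMap G α fun v => h ⟨v, trivial⟩

theorem specObtainedByGluing [Finite V] (hG : G.Connected) : SpecObtainedByGluing G α :=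
  gluesTo_top hG _ _ inferInstance isUniversal_top

end Gluing

end GraphSpline

theorem mainTheorem3 {V R : Type u} [Finite V] [CommRing R]
    (G : SimpleGraph V) (α : G.edgeSet → Ideal R) :
    (G.Connected → GraphSpline.SpecObtainedByGluing G α) ∧
    (∀ c : G.ConnectedComponent, GraphSpline.SpecObtainedByGluing c.toSimpleGraph
      (GraphSpline.pullbackLabel c.toSimpleGraph_hom α)) ∧
    Nonempty (IsColimit (Cofan.mk (Spec (CommRingCat.of (GraphSpline.splineRing G α)))
      (fun c : G.ConnectedComponent =>
        Spec.map (CommRingCat.ofHom (GraphSpline.restrictHom c.toSimpleGraph_hom α))))) ∧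
    Nonempty (IsColimit (GraphSpline.schemeCocone G α)) :=
  ⟨GraphSpline.specObtainedByGluing,
    fun c => GraphSpline.specObtainedByGluing c.connected_toSimpleGraph,
    GraphSpline.nonempty_isColimit_components G α,
    GraphSpline.nonempty_isColimit_schemeCocone G α⟩
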